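/- For complex $z$ with $|z|\le 1$, $z\ne 1$, and $v\in\mathbb{C}\setminus\{0,-1,-2,\dots\}$, let $s\mapsto\Phi(z,s,v)$ be the Hurwitz-Lerch zeta function, that is, the entire function of $s$ that is the analytic continuation of the series $$\Phi(z,s,v)=\sum_{k=0}^{\infty}\frac{z^{k}}{(v+k)^{s}},\qquad \operatorname{Re}s>1,$$ with principal powers, and let $\partial_s\Phi$ denote its partial derivative with respect to $s$. Let $K=\sum_{k=0}^{\infty}\frac{(-1)^k}{(2k+1)^2}$ be Catalan's constant. Then for every positive integer $n$ the functions $s\mapsto\Phi\bigl(-e^{2i\pi j/(2n+1)},s,\tfrac12\bigr)$, $0\le j\le 2n$, are well defined (the entire continuations exist), and $$\sum_{j=0}^{2n}(-1)^j\,e^{\frac{i\pi j}{2n+1}}\;\partial_s\Phi\!\left(-e^{\frac{2i\pi j}{2n+1}},-1,\tfrac12\right)=\frac{K}{\pi}\,(-1)^n(2n+1)^2 .$$ -/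

import Mathlib

/-- `f` is the analytic continuation in `s` of the Hurwitz-Lerch series
`Φ(z, s, v) = ∑_{k ≥ 0} z ^ k (v + k) ^ (-s)`, for `|z| ≤ 1` and `v ≠ 0, -1, -2, …`.
The series converges absolutely for `Re s > 1`; the continuation is entire if `z ≠ 1`, and
analytic away from the simple pole `s = 1` if `z = 1`. As the half-plane `Re s > 1` lies in a
connected open domain, the continuation is unique on that domain. -/
structure IsLerchContinuation (z v : ℂ) (f : ℂ → ℂ) : Prop where
  differentiableOn : DifferentiableOn ℂ f {s : ℂ | z ≠ 1 ∨ s ≠ 1}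
  hasSum : ∀ s : ℂ, 1 < s.re → HasSum (fun k : ℕ => (v + (k : ℂ)) ^ (-s) * z ^ k) (f s)

open Classical in
/-- The Hurwitz-Lerch zeta function `Φ(z, s, v)` for `|z| ≤ 1` and `v ≠ 0, -1, -2, …`: the value
at `s` of the analytic continuation of the Hurwitz-Lerch series
(and `0` if there is no continuation). -/
noncomputable def hurwitzLerchZeta (z s v : ℂ) : ℂ :=
  if h : ∃ f : ℂ → ℂ, IsLerchContinuation z v f then h.choose s else 0

/-- Catalan's constant `∑_{k ≥ 0} (-1) ^ k / (2 k + 1) ^ 2`. -/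
noncomputable def catalanConstant : ℝ :=
  ∑' k : ℕ, (-1 : ℝ) ^ k / (2 * (k : ℝ) + 1) ^ 2

/-!
Let `N = 2 n + 1` and let `ζ` be a primitive `N`-th root of unity. Orthogonality of the powers of
`ζ` extracts from `Φ(z, s, v)` the terms whose index is congruent to `r` modulo `N`, which gives
`∑ j, ζ ^ (-r j) Φ(z ζ ^ j, s, v) = N ^ (1 - s) z ^ r Φ(z ^ N, s, (v + r) / N)`, first for
`1 < Re s` and then for `s ≠ 1` by the identity theorem. For `z = -1`, `v = 1 / 2`, `r = n` the
right-hand side is again a multiple of `Φ(-1, s, 1 / 2)`, and this function is `2 ^ (1 - s)` times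
the odd Hurwitz zeta function at `1 / 4`. The latter vanishes at `s = -1`, where the functional
equation expresses its derivative through `sinZeta (1 / 4) 2`, which is Catalan's constant.
-/

open Complex HurwitzZeta Filter Topology

theorem hasSum_ite_mod_iff {α : Type*} [AddCommMonoid α] [TopologicalSpace α] {f : ℕ → α} {a : α}
    {N r : ℕ} (hr : r < N) :
    HasSum (fun k => if k % N = r then f k else 0) a ↔ HasSum (fun l => f (N * l + r)) a := by
  have hinj : Function.Injective fun l : ℕ => N * l + r := fun l m hlm => by
    simpa [(Nat.zero_lt_of_lt hr).ne'] using hlm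
  rw [← hinj.hasSum_iff]
  · simp [Function.comp_def, Nat.mod_eq_of_lt hr]
  · intro k hk
    refine if_neg fun hkr => hk ⟨k / N, ?_⟩
    simp only [← hkr, Nat.div_add_mod]

theorem sum_inv_pow_mul_pow_eq_ite {K : Type*} [Field K] {ζ : K} {N r : ℕ}
    (hζ : IsPrimitiveRoot ζ N) (hr : r < N) (k : ℕ) :
    ∑ j ∈ Finset.range N, (ζ ^ (r * j))⁻¹ * (ζ ^ j) ^ k = if k % N = r then (N : K) else 0 := by
  have hN : N ≠ 0 := (Nat.zero_lt_of_lt hr).ne'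
  have hζr : ζ ^ r ≠ 0 := pow_ne_zero r (hζ.ne_zero hN)
  have hgeom : ∑ j ∈ Finset.range N, (ζ ^ (r * j))⁻¹ * (ζ ^ j) ^ k =
      ∑ j ∈ Finset.range N, (ζ ^ k / ζ ^ r) ^ j := by
    refine Finset.sum_congr rfl fun j _ => ?_
    rw [div_pow, ← pow_mul, ← pow_mul, ← pow_mul, mul_comm j k, inv_mul_eq_div]
  have hratio : ζ ^ k / ζ ^ r = 1 ↔ k % N = r := by
    rw [div_eq_one_iff_eq hζr, (hζ.isOfFinOrder hN).pow_inj_mod, ← hζ.eq_orderOf,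
      Nat.mod_eq_of_lt hr]
  rw [hgeom]
  split_ifs with hkr
  · simp [hratio.mpr hkr]
  · have hpow : (ζ ^ k / ζ ^ r) ^ N = 1 := by
      rw [div_pow, pow_right_comm, pow_right_comm ζ r, hζ.pow_eq_one, one_pow, one_pow, div_one]
    simpa [hpow, sub_ne_zero.mpr (mt hratio.mp hkr)] using geom_sum_mul (ζ ^ k / ζ ^ r) N

theorem ofReal_mul_cpow_of_nonneg {x : ℝ} (hx : 0 ≤ x) (w s : ℂ) :
    (x * w) ^ s = (x : ℂ) ^ s * w ^ s := by
  rcases eq_or_ne s 0 with rfl | hs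
  · simp
  rcases hx.eq_or_lt with rfl | hx
  · simp [zero_cpow hs]
  rcases eq_or_ne w 0 with rfl | hw
  · simp [zero_cpow hs]
  have hx' : (x : ℂ) ≠ 0 := ofReal_ne_zero.mpr hx.ne'
  rw [cpow_def_of_ne_zero (mul_ne_zero hx' hw), cpow_def_of_ne_zero hx', cpow_def_of_ne_zero hw,
    log_ofReal_mul hx hw, ofReal_log hx.le, add_mul, exp_add]

theorem eqOn_compl_singleton_of_eqOn_lt_re {E : Type*} [NormedAddCommGroup E] [NormedSpace ℂ E]
    [CompleteSpace E] {f g : ℂ → E} {c : ℂ} {x : ℝ} (hf : DifferentiableOn ℂ f {c}ᶜ)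
    (hg : DifferentiableOn ℂ g {c}ᶜ) (hfg : Set.EqOn f g {s | x < s.re}) :
    Set.EqOn f g {c}ᶜ := by
  obtain ⟨y, hxy⟩ := exists_gt (max x c.re)
  obtain ⟨hx, hc⟩ := max_lt_iff.mp hxy
  have hy : (y : ℂ) ∈ ({c}ᶜ : Set ℂ) := fun hyc => hc.ne' (congrArg re hyc)
  have hconn : IsPreconnected ({c}ᶜ : Set ℂ) :=
    (isConnected_compl_singleton_of_one_lt_rank (by simp) c).isPreconnected
  refine (hf.analyticOnNhd isOpen_compl_singleton).eqOn_of_preconnected_of_eventuallyEq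
    (hg.analyticOnNhd isOpen_compl_singleton) hconn hy ?_
  exact hfg.eventuallyEq_of_mem ((isOpen_lt continuous_const continuous_re).mem_nhds hx)

theorem differentiable_sum_mul_hurwitzZeta {ι : Type*} {t : Finset ι} {c : ι → ℂ}
    (hc : ∑ i ∈ t, c i = 0) (a : ι → UnitAddCircle) :
    Differentiable ℂ fun s => ∑ i ∈ t, c i * hurwitzZeta (a i) s := by
  have hsub : (fun s => ∑ i ∈ t, c i * hurwitzZeta (a i) s) =
      fun s => ∑ i ∈ t, c i * (hurwitzZeta (a i) s - hurwitzZeta 0 s) := by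
    funext s
    simp only [mul_sub, Finset.sum_sub_distrib, ← Finset.sum_mul, hc, zero_mul, sub_zero]
  rw [hsub]
  exact Differentiable.fun_sum fun i _ =>
    (differentiable_hurwitzZeta_sub_hurwitzZeta (a i) 0).const_mul (c i)

theorem hasDerivAt_sin_pi_mul_div_two (k : ℕ) :
    HasDerivAt (fun s : ℂ => sin (Real.pi * s / 2)) ((-1) ^ k * (Real.pi / 2)) (2 * k) := by
  have hangle : Real.pi * (2 * k : ℂ) / 2 = (k * Real.pi : ℝ) := by push_cast; ring
  refine (((hasDerivAt_id (2 * k : ℂ)).const_mul (Real.pi : ℂ)).div_const 2).csin.congr_deriv ?_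
  simp only [id, hangle, ← ofReal_cos, Real.cos_nat_mul_pi]
  push_cast
  ring

theorem hasDerivAt_hurwitzZetaOdd_one_sub_two_mul_nat (a : UnitAddCircle) {k : ℕ} (hk : k ≠ 0) :
    HasDerivAt (hurwitzZetaOdd a)
      (-((-1) ^ k * Real.pi * (2 * Real.pi) ^ (-(2 * k) : ℂ) * Gamma (2 * k) *
        sinZeta a (2 * k))) (1 - 2 * k) := by
  set A : ℂ → ℂ := fun s => 2 * (2 * Real.pi) ^ (-s) * Gamma s * sinZeta a s
  have ne_neg_nat {s : ℂ} (hs : 0 < s.re) (m : ℕ) : s ≠ -m := by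
    rintro rfl
    simp [(Nat.cast_nonneg m).not_gt] at hs
  have hre : 0 < (2 * k : ℂ).re := by simpa using Nat.pos_of_ne_zero hk
  have hA : DifferentiableAt ℂ A (2 * k) :=
    (((differentiableAt_id.neg.const_cpow (.inl (by simp))).const_mul 2).mul
      (differentiableAt_Gamma _ (ne_neg_nat hre))).mul (differentiableAt_sinZeta a _)
  have hfe : (fun s => hurwitzZetaOdd a (1 - s)) =ᶠ[𝓝 (2 * k : ℂ)]
      fun s => A s * sin (Real.pi * s / 2) := by
    filter_upwards [(isOpen_lt continuous_const continuous_re).mem_nhds hre] with s hs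
    rw [hurwitzZetaOdd_one_sub a (ne_neg_nat hs)]
    ring
  have hzero : sin (Real.pi * (2 * k : ℂ) / 2) = 0 := by
    rw [mul_left_comm, mul_div_cancel_left₀ _ two_ne_zero, mul_comm, sin_nat_mul_pi]
  have hreflected := (hA.hasDerivAt.mul (hasDerivAt_sin_pi_mul_div_two k)).congr_of_eventuallyEq hfe
  have hcomp := HasDerivAt.comp_const_sub 1 (1 - 2 * k : ℂ) (by rwa [sub_sub_self])
  simp only [sub_sub_self] at hcomp
  refine hcomp.congr_deriv ?_
  rw [hzero]
  ring

theorem hurwitzZetaOdd_neg_one (a : UnitAddCircle) : hurwitzZetaOdd a (-1) = 0 := by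
  simpa using hurwitzZetaOdd_neg_two_mul_nat_sub_one a 0

theorem deriv_hurwitzZetaOdd_neg_one (a : UnitAddCircle) :
    deriv (hurwitzZetaOdd a) (-1) = sinZeta a 2 / (4 * Real.pi) := by
  have hderiv := (hasDerivAt_hurwitzZetaOdd_one_sub_two_mul_nat a one_ne_zero).deriv
  rw [Nat.cast_one, mul_one, show (1 : ℂ) - 2 = -1 by norm_num, Gamma_ofNat_eq_factorial,
    cpow_neg, cpow_ofNat] at hderiv
  rw [hderiv]
  simp only [pow_one, neg_mul, one_mul, Nat.factorial_one, Nat.cast_one, mul_one, neg_neg]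
  field_simp
  ring

theorem hasSum_sinZeta_one_quarter {s : ℂ} (hs : 1 < s.re) :
    HasSum (fun l : ℕ => (-1 : ℂ) ^ l / (2 * l + 1) ^ s) (sinZeta (1 / 4 : ℝ) s) := by
  have hsum := hasSum_nat_sinZeta (1 / 4) hs
  have hodd (k : ℕ) : (Real.sin (2 * Real.pi * (1 / 4) * k) : ℂ) / (k : ℂ) ^ s =
      if k % 2 = 1 then (Real.sin (2 * Real.pi * (1 / 4) * k) : ℂ) / (k : ℂ) ^ s else 0 := by
    split_ifs with hk
    · rfl
    · obtain ⟨m, rfl⟩ : 2 ∣ k := by lia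
      rw [show 2 * Real.pi * (1 / 4) * (2 * m : ℕ) = m * Real.pi by push_cast; ring,
        Real.sin_nat_mul_pi, ofReal_zero, zero_div]
  rw [funext hodd, hasSum_ite_mod_iff one_lt_two] at hsum
  refine hsum.congr_fun fun l => ?_
  rw [show 2 * Real.pi * (1 / 4) * (2 * l + 1 : ℕ) = Real.pi / 2 + l * Real.pi by push_cast; ring,
    Real.sin_add_nat_mul_pi, Real.sin_pi_div_two, mul_one]
  push_cast
  rfl

theorem sinZeta_one_quarter_two : sinZeta (1 / 4 : ℝ) 2 = catalanConstant := by
  rw [← (hasSum_sinZeta_one_quarter (by norm_num)).tsum_eq, catalanConstant]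
  push_cast [cpow_ofNat]
  rfl

theorem deriv_two_cpow_mul_hurwitzZetaOdd_neg_one :
    deriv (fun s : ℂ => 2 ^ (1 - s) * hurwitzZetaOdd (1 / 4 : ℝ) s) (-1) =
      (catalanConstant / Real.pi : ℂ) := by
  have hpow : DifferentiableAt ℂ (fun s : ℂ => (2 : ℂ) ^ (1 - s)) (-1) :=
    (differentiableAt_id.const_sub 1).const_cpow (.inl two_ne_zero)
  rw [deriv_fun_mul hpow (differentiable_hurwitzZetaOdd _ _), hurwitzZetaOdd_neg_one,
    deriv_hurwitzZetaOdd_neg_one, sinZeta_one_quarter_two, sub_neg_eq_add, one_add_one_eq_two,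
    cpow_ofNat]
  ring

theorem cpow_mul_pow_mul_add {N : ℕ} (hN : N ≠ 0) (z v s : ℂ) (l r : ℕ) :
    (v + (N * l + r : ℕ)) ^ s * z ^ (N * l + r) =
      N ^ s * z ^ r * (((v + r) / N + l) ^ s * (z ^ N) ^ l) := by
  have hN' : (N : ℂ) ≠ 0 := Nat.cast_ne_zero.mpr hN
  have hbase : v + (N * l + r : ℕ) = (N : ℝ) * ((v + r) / N + l) := by
    push_cast
    field_simp
    ring
  rw [hbase, ofReal_mul_cpow_of_nonneg N.cast_nonneg, ofReal_natCast, pow_add, pow_mul]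
  ring

theorem hasSum_lerchSeries_of_residueClasses {N : ℕ} (hN : N ≠ 0) {z v s : ℂ} {a : ℕ → ℂ}
    (ha : ∀ r < N, HasSum (fun l : ℕ => ((v + r) / N + l) ^ (-s) * (z ^ N) ^ l) (a r)) :
    HasSum (fun k : ℕ => (v + (k : ℂ)) ^ (-s) * z ^ k)
      (N ^ (-s) * ∑ r ∈ Finset.range N, z ^ r * a r) := by
  have hclass (r : ℕ) (hr : r ∈ Finset.range N) :
      HasSum (fun k : ℕ => if k % N = r then (v + (k : ℂ)) ^ (-s) * z ^ k else 0)
        (N ^ (-s) * z ^ r * a r) := by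
    rw [Finset.mem_range] at hr
    rw [hasSum_ite_mod_iff hr]
    simp only [cpow_mul_pow_mul_add hN]
    exact (ha r hr).mul_left _
  have hsum := hasSum_sum hclass
  simp only [Finset.sum_ite_eq, Finset.mem_range, Nat.mod_lt _ (Nat.pos_of_ne_zero hN), if_true,
    mul_assoc, ← Finset.mul_sum] at hsum
  exact hsum

theorem isLerchContinuation_of_pow_eq_one {N : ℕ} (hN : N ≠ 0) {z : ℂ} (hz : z ^ N = 1) {v : ℝ}
    (hv : v ∈ Set.Icc 0 1) :
    IsLerchContinuation z v fun s =>
      N ^ (-s) * ∑ r ∈ Finset.range N, z ^ r * hurwitzZeta ((v + r) / N : ℝ) s where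
  differentiableOn := by
    have hpow : Differentiable ℂ fun s : ℂ => (N : ℂ) ^ (-s) :=
      differentiable_neg.const_cpow (.inl (Nat.cast_ne_zero.mpr hN))
    rintro s (hz1 | hs)
    · have hgeom : ∑ r ∈ Finset.range N, z ^ r = 0 := by
        simpa [hz, sub_ne_zero.mpr hz1] using geom_sum_mul z N
      exact (hpow.mul (differentiable_sum_mul_hurwitzZeta hgeom _) s).differentiableWithinAt
    · exact ((hpow s).mul <| DifferentiableAt.fun_sum fun r _ =>
        (differentiableAt_hurwitzZeta _ hs).const_mul (z ^ r)).differentiableWithinAt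
  hasSum s hs := by
    refine hasSum_lerchSeries_of_residueClasses hN fun r hr => ?_
    have hmem : (v + r) / N ∈ Set.Icc (0 : ℝ) 1 := by
      have hrN : (r : ℝ) + 1 ≤ N := by exact_mod_cast hr
      exact ⟨div_nonneg (add_nonneg hv.1 r.cast_nonneg) N.cast_nonneg,
        div_le_one_of_le₀ (by linarith [hv.2]) N.cast_nonneg⟩
    refine (hasSum_hurwitzZeta_of_one_lt_re hmem hs).congr_fun fun l => ?_
    rw [hz, one_pow, mul_one, cpow_neg, one_div, add_comm]
    push_cast
    rfl

theorem isLerchContinuation_neg_one_half :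
    IsLerchContinuation (-1) (1 / 2) fun s => 2 ^ (1 - s) * hurwitzZetaOdd (1 / 4 : ℝ) s := by
  have hreflect : ((3 / 4 : ℝ) : UnitAddCircle) = -(1 / 4 : ℝ) := by
    rw [← AddCircle.coe_neg, ← AddCircle.coe_add_period 1 (-(1 / 4))]
    norm_num
  convert! isLerchContinuation_of_pow_eq_one two_ne_zero neg_one_sq
    (v := 1 / 2) ⟨by norm_num, by norm_num⟩ using 1
  · norm_num
  · funext s
    rw [hurwitzZetaOdd_eq, ← hreflect, sub_eq_add_neg 1 s, cpow_add _ _ two_ne_zero, cpow_one,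
      Finset.sum_range_succ, Finset.sum_range_one]
    norm_num
    ring

theorem isLerchContinuation_hurwitzLerchZeta {z v : ℂ} {f : ℂ → ℂ}
    (hf : IsLerchContinuation z v f) :
    IsLerchContinuation z v fun s => hurwitzLerchZeta z s v := by
  have hex : ∃ f : ℂ → ℂ, IsLerchContinuation z v f := ⟨f, hf⟩
  simpa only [hurwitzLerchZeta, dif_pos hex] using hex.choose_spec

theorem isLerchContinuation_hurwitzLerchZeta_neg_pow {N : ℕ} (hN : N ≠ 0) {ζ : ℂ}
    (hζ : ζ ^ N = 1) (j : ℕ) :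
    IsLerchContinuation (-ζ ^ j) (1 / 2) fun s => hurwitzLerchZeta (-ζ ^ j) s (1 / 2) := by
  have hpow : (-ζ ^ j) ^ (2 * N) = 1 := by
    rw [pow_mul, neg_sq, ← pow_mul, pow_right_comm, pow_mul', hζ, one_pow, one_pow]
  have hv : (1 / 2 : ℝ) ∈ Set.Icc 0 1 := by norm_num
  have hΦ := isLerchContinuation_hurwitzLerchZeta
    (isLerchContinuation_of_pow_eq_one (mul_ne_zero two_ne_zero hN) hpow hv)
  simpa only [ofReal_div, ofReal_one, ofReal_ofNat] using hΦ

theorem IsLerchContinuation.differentiableOn_compl_one {z v : ℂ} {f : ℂ → ℂ}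
    (hf : IsLerchContinuation z v f) : DifferentiableOn ℂ f {1}ᶜ :=
  hf.differentiableOn.mono fun _ hs => Or.inr hs

theorem sum_inv_pow_mul_lerchSeries {N r : ℕ} {ζ z v s b : ℂ} {a : ℕ → ℂ}
    (hζ : IsPrimitiveRoot ζ N) (hr : r < N)
    (ha : ∀ j ∈ Finset.range N,
      HasSum (fun k : ℕ => (v + (k : ℂ)) ^ (-s) * (z * ζ ^ j) ^ k) (a j))
    (hb : HasSum (fun l : ℕ => ((v + r) / N + (l : ℂ)) ^ (-s) * (z ^ N) ^ l) b) :
    ∑ j ∈ Finset.range N, (ζ ^ (r * j))⁻¹ * a j = N ^ (1 - s) * z ^ r * b := by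
  have hN : N ≠ 0 := (Nat.zero_lt_of_lt hr).ne'
  have hfilter (k : ℕ) :
      ∑ j ∈ Finset.range N, (ζ ^ (r * j))⁻¹ * ((v + (k : ℂ)) ^ (-s) * (z * ζ ^ j) ^ k) =
        if k % N = r then N * ((v + (k : ℂ)) ^ (-s) * z ^ k) else 0 := by
    rw [← ite_zero_mul, ← sum_inv_pow_mul_pow_eq_ite hζ hr k, Finset.sum_mul]
    refine Finset.sum_congr rfl fun j _ => ?_
    rw [mul_pow]
    ring
  have hsum := hasSum_sum fun j hj => (ha j hj).mul_left (ζ ^ (r * j))⁻¹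
  simp only [hfilter, hasSum_ite_mod_iff hr, cpow_mul_pow_mul_add hN] at hsum
  refine hsum.unique (HasSum.congr_fun (hb.mul_left (N ^ (1 - s) * z ^ r)) fun l => ?_)
  rw [sub_eq_add_neg, cpow_add _ _ (Nat.cast_ne_zero.mpr hN), cpow_one]
  ring

theorem sum_inv_pow_mul_eqOn_of_isLerchContinuation {N r : ℕ} {ζ z v : ℂ} {F : ℕ → ℂ → ℂ}
    {G : ℂ → ℂ} (hζ : IsPrimitiveRoot ζ N) (hr : r < N)
    (hF : ∀ j ∈ Finset.range N, IsLerchContinuation (z * ζ ^ j) v (F j))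
    (hG : IsLerchContinuation (z ^ N) ((v + r) / N) G) :
    Set.EqOn (fun s => ∑ j ∈ Finset.range N, (ζ ^ (r * j))⁻¹ * F j s)
      (fun s => N ^ (1 - s) * z ^ r * G s) {1}ᶜ := by
  have hN : (N : ℂ) ≠ 0 := Nat.cast_ne_zero.mpr (Nat.zero_lt_of_lt hr).ne'
  have hpow : Differentiable ℂ fun s : ℂ => (N : ℂ) ^ (1 - s) * z ^ r :=
    ((differentiable_id.const_sub 1).const_cpow (.inl hN)).mul_const _
  refine eqOn_compl_singleton_of_eqOn_lt_re (x := 1)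
    (DifferentiableOn.fun_sum fun j hj => (hF j hj).differentiableOn_compl_one.const_mul _)
    (hpow.differentiableOn.mul hG.differentiableOn_compl_one) fun s hs => ?_
  exact sum_inv_pow_mul_lerchSeries hζ hr (fun j hj => (hF j hj).hasSum s hs) (hG.hasSum s hs)

theorem sum_inv_pow_mul_deriv_of_isLerchContinuation {N r : ℕ} {ζ z v s : ℂ} {F : ℕ → ℂ → ℂ}
    {G : ℂ → ℂ} (hζ : IsPrimitiveRoot ζ N) (hr : r < N)
    (hF : ∀ j ∈ Finset.range N, IsLerchContinuation (z * ζ ^ j) v (F j))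
    (hG : IsLerchContinuation (z ^ N) ((v + r) / N) G) (hs : s ≠ 1) (hGs : G s = 0) :
    ∑ j ∈ Finset.range N, (ζ ^ (r * j))⁻¹ * deriv (F j) s = N ^ (1 - s) * z ^ r * deriv G s := by
  have hN : (N : ℂ) ≠ 0 := Nat.cast_ne_zero.mpr (Nat.zero_lt_of_lt hr).ne'
  have hnhds : ({1}ᶜ : Set ℂ) ∈ 𝓝 s := isOpen_compl_singleton.mem_nhds hs
  have hleft : HasDerivAt (fun s => ∑ j ∈ Finset.range N, (ζ ^ (r * j))⁻¹ * F j s)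
      (∑ j ∈ Finset.range N, (ζ ^ (r * j))⁻¹ * deriv (F j) s) s :=
    HasDerivAt.fun_sum fun j hj =>
      ((hF j hj).differentiableOn_compl_one.differentiableAt hnhds).hasDerivAt.const_mul _
  have hpow : DifferentiableAt ℂ (fun s : ℂ => (N : ℂ) ^ (1 - s) * z ^ r) s :=
    ((differentiableAt_id.const_sub 1).const_cpow (.inl hN)).mul_const _
  have hright := hpow.hasDerivAt.mul
    (hG.differentiableOn_compl_one.differentiableAt hnhds).hasDerivAt
  have heq := (sum_inv_pow_mul_eqOn_of_isLerchContinuation hζ hr hF hG).eventuallyEq_of_mem hnhds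
  rw [hleft.unique (hright.congr_of_eventuallyEq heq), hGs, mul_zero, zero_add]

theorem sum_inv_pow_mul_deriv_hurwitzLerchZeta_neg_pow {n : ℕ} {ζ : ℂ}
    (hζ : IsPrimitiveRoot ζ (2 * n + 1)) :
    ∑ j ∈ Finset.range (2 * n + 1),
      (ζ ^ (n * j))⁻¹ * deriv (fun s => hurwitzLerchZeta (-ζ ^ j) s (1 / 2)) (-1) =
        catalanConstant / Real.pi * (-1) ^ n * (2 * n + 1) ^ 2 := by
  have hΦ (j : ℕ) := isLerchContinuation_hurwitzLerchZeta_neg_pow (by positivity) hζ.pow_eq_one j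
  have hG : IsLerchContinuation ((-1) ^ (2 * n + 1)) ((1 / 2 + n) / (2 * n + 1 : ℕ))
      fun s => 2 ^ (1 - s) * hurwitzZetaOdd (1 / 4 : ℝ) s := by
    have hN : (2 * (n : ℂ) + 1) ≠ 0 := by exact_mod_cast (2 * n).succ_ne_zero
    have hmid : (1 / 2 + n : ℂ) / (2 * n + 1 : ℕ) = 1 / 2 := by
      push_cast
      field_simp
      ring
    rw [Odd.neg_one_pow ⟨n, rfl⟩, hmid]
    exact isLerchContinuation_neg_one_half
  rw [sum_inv_pow_mul_deriv_of_isLerchContinuation hζ (by lia)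
    (fun j _ => by simpa only [neg_one_mul] using hΦ j) hG (by norm_num)
    (by rw [hurwitzZetaOdd_neg_one, mul_zero]), deriv_two_cpow_mul_hurwitzZetaOdd_neg_one,
    sub_neg_eq_add, one_add_one_eq_two, cpow_ofNat]
  push_cast
  ring

theorem neg_one_pow_mul_exp_pi_mul_I_div (n j : ℕ) :
    (-1) ^ j * exp (I * Real.pi * j / (2 * n + 1)) =
      (exp (2 * Real.pi * I / (2 * n + 1 : ℕ)) ^ (n * j))⁻¹ := by
  have hN : (2 * (n : ℂ) + 1) ≠ 0 := by exact_mod_cast (2 * n).succ_ne_zero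
  have hneg : (-1 : ℂ) = exp (-(Real.pi * I)) := by rw [exp_neg, exp_pi_mul_I, inv_neg_one]
  rw [hneg, ← exp_nat_mul, ← exp_nat_mul, ← exp_add, ← exp_neg]
  congr 1
  push_cast
  field_simp
  ring

theorem mainTheorem5 (n : ℕ) (hn : 0 < n) :
    (∀ j ∈ Finset.range (2 * n + 1),
      IsLerchContinuation (-Complex.exp (2 * Complex.I * Real.pi * j / (2 * n + 1))) (1 / 2)
        (fun s : ℂ => hurwitzLerchZeta
          (-Complex.exp (2 * Complex.I * Real.pi * j / (2 * n + 1))) s (1 / 2))) ∧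
    ∑ j ∈ Finset.range (2 * n + 1),
      (-1 : ℂ) ^ j * Complex.exp (Complex.I * Real.pi * j / (2 * n + 1)) *
        deriv (fun s : ℂ => hurwitzLerchZeta
          (-Complex.exp (2 * Complex.I * Real.pi * j / (2 * n + 1))) s (1 / 2)) (-1) =
      (catalanConstant : ℂ) / Real.pi * (-1) ^ n * (2 * n + 1) ^ 2 := by
  have hζ := isPrimitiveRoot_exp _ (2 * n).succ_ne_zero
  have hpow (j : ℕ) : exp (2 * I * Real.pi * j / (2 * n + 1)) =
      exp (2 * Real.pi * I / (2 * n + 1 : ℕ)) ^ j := by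
    rw [← exp_nat_mul]
    push_cast
    ring_nf
  simp only [hpow, neg_one_pow_mul_exp_pi_mul_I_div]
  exact ⟨fun j _ => isLerchContinuation_hurwitzLerchZeta_neg_pow (by positivity) hζ.pow_eq_one j,
    sum_inv_pow_mul_deriv_hurwitzLerchZeta_neg_pow hζ⟩
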